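/- Let $2\le p<\infty$, let $d\ge 2$ be an integer and put $k=\lfloor d/2\rfloor$. For a complex polynomial $P$ let $\|P\|_\infty=\max_{|z|=1}|P(z)|$ and $\|P\|_p=\bigl(\int_{-\pi}^{\pi}|P(e^{i\theta})|^p\,\frac{d\theta}{2\pi}\bigr)^{1/p}$, and let $\mathscr C_{d,p}$ be the smallest constant $C$ such that $\|P\|_\infty^p\le C\|P\|_p^p$ for every polynomial $P$ of degree at most $d$. Let $T_d$ be the set of real sequences $\tau=(\tau_0,\dots,\tau_{k+1})$ with $0=\tau_0\le\tau_1\le\dots\le\tau_{k+1}=\pi$. For $\tau\in T_d$ and $0<\theta<\pi$ put $$K_{d,p}(\tau;\theta)=\sum_{n=0}^{k}\chi_{(\tau_n,\tau_{n+1})}(\theta)\,\frac{\sin\bigl((\frac{dp}{4}+\frac12)\theta-\frac p2\pi n\bigr)}{\sin(\theta/2)},$$ and for non-empty $\Lambda\subseteq T_d$ put $M_{d,p}^{\Lambda}(\theta)=\max_{\tau\in\Lambda}\max(K_{d,p}(\tau;\theta),0)$; write $M_{d,p}=M_{d,p}^{T_d}$. Then, with integrals taking values in $[0,\infty]$, $$\mathscr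 C_{d,p}\le\frac1\pi\int_0^\pi M_{d,p}(\theta)^2\,d\theta .$$ Moreover, $T_d$ may be replaced by any smaller set of sequences that contains the arguments of the zeros of an extremal polynomial: there are a polynomial $\varphi$ that minimizes $\|P\|_p^p$ among all polynomials $P$ of degree at most $d$ with $P(1)=1$, and a sequence $t\in T_d$, such that the zeros of $\varphi$, counted with multiplicity, are $e^{\pm it_1},\dots,e^{\pm it_k}$, together with $-1$ if $d$ is odd, and such that for every $\Lambda\subseteq T_d$ with $t\in\Lambda$ $$\mathscr C_{d,p}\le\frac1\pi\int_0^\pi M_{d,p}^{\Lambda}(\theta)^2\,d\theta .$$ In particular (take $\Lambda=\{t\}$), $\mathscr C_{d,p}\le\frac1\pi\int_0^\pi \max(K_{d,p}(t;\theta),0)^2\,d\theta$. -/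

import Mathlib

open Polynomial

noncomputable section

namespace PointEval

/-- The supremum norm of a polynomial on the unit circle. -/
def supNorm (P : ℂ[X]) : ℝ := ⨆ z : Circle, ‖P.eval (z : ℂ)‖

/-- The `L^p` norm of a polynomial on the unit circle, with normalized arc length `dθ / 2π`. -/
def lpNorm (p : ℝ) (P : ℂ[X]) : ℝ :=
  (∫ θ in (-Real.pi)..Real.pi,
    ‖P.eval (Complex.exp (θ * Complex.I))‖ ^ p / (2 * Real.pi)) ^ (1 / p)

/-- The smallest `C` with `‖P‖_∞ ^ p ≤ C ‖P‖_p ^ p` for all polynomials of degree at most `d`. -/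
def nikolskiiConst (d : ℕ) (p : ℝ) : ℝ :=
  sInf {C : ℝ | ∀ P : ℂ[X], P.natDegree ≤ d → supNorm P ^ p ≤ C * lpNorm p P ^ p}

/-- `φ` minimizes `‖P‖_p ^ p` among the polynomials `P` of degree at most `d` with `P(1) = 1`. -/
structure IsExtremal (d : ℕ) (p : ℝ) (φ : ℂ[X]) : Prop where
  natDegree_le : φ.natDegree ≤ d
  eval_one : φ.eval 1 = 1
  le : ∀ P : ℂ[X], P.natDegree ≤ d → P.eval 1 = 1 → lpNorm p φ ^ p ≤ lpNorm p P ^ p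

/-- Non-decreasing sequences `0 = τ_0 ≤ τ_1 ≤ ⋯ ≤ τ_{k+1} = π`, where `k = ⌊d/2⌋`. -/
def T (d : ℕ) : Set (Fin (d / 2 + 2) → ℝ) :=
  {τ | Monotone τ ∧ τ 0 = 0 ∧ τ (Fin.last (d / 2 + 1)) = Real.pi}

/-- The zeros of `φ`, with multiplicity, are `e^{± i τ_1}, …, e^{± i τ_k}`, and in addition `-1`
if `d` is odd. -/
def HasZeroArgs (d : ℕ) (φ : ℂ[X]) (τ : Fin (d / 2 + 2) → ℝ) : Prop :=
  ∃ c : ℂ, c ≠ 0 ∧ φ = C c * (X + 1) ^ (d % 2) * ∏ j : Fin (d / 2),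
    ((X - C (Complex.exp (τ j.succ.castSucc * Complex.I))) *
      (X - C (Complex.exp (-(τ j.succ.castSucc * Complex.I)))))

/-- The piecewise kernel `K_{d,p}(τ; θ)`. -/
def K (d : ℕ) (p : ℝ) (τ : Fin (d / 2 + 2) → ℝ) (θ : ℝ) : ℝ :=
  ∑ n : Fin (d / 2 + 1), (Set.Ioo (τ n.castSucc) (τ n.succ)).indicator
    (fun x : ℝ => Real.sin ((d * p / 4 + 1 / 2) * x - p / 2 * Real.pi * (n : ℕ)) /
      Real.sin (x / 2)) θ

/-- The maximum over `τ ∈ Λ` of the positive part of `K_{d,p}(τ; θ)`. For fixed `θ` only finitely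
many values occur, so that the supremum is a maximum when `Λ` is non-empty. -/
def M (d : ℕ) (p : ℝ) (Λ : Set (Fin (d / 2 + 2) → ℝ)) (θ : ℝ) : ℝ :=
  sSup ((fun τ => max (K d p τ θ) 0) '' Λ)

/-- `(1/π) ∫_0^π M_{d,p}(θ)² dθ`, with value in `[0, ∞]`: the integrand is non-negative, and its
integral may diverge at `θ = 0`. -/
def energy (d : ℕ) (p : ℝ) (Λ : Set (Fin (d / 2 + 2) → ℝ)) : ENNReal :=
  ENNReal.ofReal (1 / Real.pi) *
    ∫⁻ θ in Set.Icc 0 Real.pi, ENNReal.ofReal (M d p Λ θ ^ 2)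

end PointEval

end

/-!
An extremal polynomial `φ` exists by compactness, and rotating and scaling a competitor shows that
`𝒞_{d,p} ≤ 1 / ‖φ‖_p ^ p`. Averaging `φ` with its conjugate makes its coefficients real. By strict
convexity of the norm on `ℂ`, an extremal polynomial is determined by its modulus on the unit
circle; comparing `φ` with `X * φ` shows that its degree is exactly `d`, and reflecting a zero in
the circle shows that all zeros lie on the circle.

Hence `φ ^ (p / 2)` has, up to a constant factor, a branch in the disc, continuous up to the circle,
whose phase at `e^{iθ}` is linear in `θ` apart from jumps at the zeros. Cauchy's formula at the
boundary point `1` then becomes `π * φ(1) ^ (p / 2) = ∫₀^π |φ(e^{iθ})| ^ (p / 2) * K(t; θ) dθ`.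
Discarding the negative part of `K` and applying the Cauchy–Schwarz inequality yields the bound.
-/

open Metric MeasureTheory Set
open scoped ComplexConjugate Real

namespace PointEval

section CircleAverage

variable {E : Type*} [NormedAddCommGroup E] [NormedSpace ℝ E]

theorem circleMap_zero_one_neg (θ : ℝ) : circleMap 0 1 (-θ) = conj (circleMap 0 1 θ) := by
  simp [circleMap_zero, ← Complex.exp_conj]

theorem circleAverage_eq_integral_neg_pi_pi (f : ℂ → E) (c : ℂ) (R : ℝ) :
    Real.circleAverage f c R = (2 * π)⁻¹ • ∫ θ in -π..π, f (circleMap c R θ) := by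
  have h := ((periodic_circleMap c R).comp f).intervalIntegral_add_eq 0 (-π)
  rw [zero_add, show -π + 2 * π = π by ring] at h
  rw [Real.circleAverage_def]
  exact congrArg _ h

theorem circleAverage_comp_mul_left {z : ℂ} (hz : ‖z‖ = 1) (f : ℂ → E) (R : ℝ) :
    Real.circleAverage (fun w => f (z * w)) 0 R = Real.circleAverage f 0 R := by
  have hmul (θ : ℝ) : z * circleMap 0 R θ = circleMap 0 R (θ + z.arg) := by
    conv_lhs => rw [← Complex.norm_mul_exp_arg_mul_I z]
    rw [hz, Complex.ofReal_one, one_mul, circleMap_zero, circleMap_zero, Complex.ofReal_add,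
      add_mul, Complex.exp_add]
    ring
  rw [Real.circleAverage_eq_integral_add (f := f) z.arg, Real.circleAverage_def]
  simp only [hmul]

theorem circleAverage_comp_conj (f : ℂ → E) :
    Real.circleAverage (fun z => f (conj z)) 0 1 = Real.circleAverage f 0 1 := by
  rw [← Real.circleAverage_zero_one_congr_inv (f := f)]
  refine Real.circleAverage_congr_sphere fun z hz => ?_
  rw [abs_one, mem_sphere_zero_iff_norm] at hz
  exact congrArg f (Complex.inv_eq_conj hz).symm

theorem integral_zero_pi_circleMap {f : ℂ → E} (hf : CircleIntegrable f 0 1)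
    (hconj : ∀ z ∈ sphere (0 : ℂ) 1, f (conj z) = f z) :
    ∫ θ in 0..π, f (circleMap 0 1 θ) = π • Real.circleAverage f 0 1 := by
  have hint (a b : ℝ) : IntervalIntegrable (fun θ => f (circleMap 0 1 θ)) volume a b :=
    ((periodic_circleMap 0 1).comp f).intervalIntegrable₀ Real.two_pi_pos.ne' hf a b
  have hneg : ∫ θ in -π..0, f (circleMap 0 1 θ) = ∫ θ in 0..π, f (circleMap 0 1 θ) := by
    have h := intervalIntegral.integral_comp_neg (a := 0) (b := π) fun θ => f (circleMap 0 1 θ)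
    rw [neg_zero] at h
    rw [← h]
    refine intervalIntegral.integral_congr fun θ _ => ?_
    simp only [circleMap_zero_one_neg]
    exact hconj _ (circleMap_mem_sphere 0 zero_le_one θ)
  rw [circleAverage_eq_integral_neg_pi_pi,
    ← intervalIntegral.integral_add_adjacent_intervals (hint (-π) 0) (hint 0 π), hneg,
    ← two_smul ℝ, smul_smul, smul_smul, mul_inv_rev, mul_assoc,
    inv_mul_cancel_right₀ two_ne_zero, mul_inv_cancel₀ Real.pi_ne_zero, one_smul]

theorem circleAverage_lt_circleAverage {f g : ℂ → ℝ} {c : ℂ} {R : ℝ}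
    (hf : ContinuousOn f (sphere c |R|)) (hg : ContinuousOn g (sphere c |R|))
    (hle : ∀ z ∈ sphere c |R|, f z ≤ g z) (hlt : ∃ z ∈ sphere c |R|, f z < g z) :
    Real.circleAverage f c R < Real.circleAverage g c R := by
  obtain ⟨z, hz, hfg⟩ := hlt
  obtain ⟨θ, hθ, rfl⟩ := (image_circleMap_Ioc c R).symm ▸ hz
  have hcircle {h : ℂ → ℝ} (hh : ContinuousOn h (sphere c |R|)) :
      ContinuousOn (fun θ => h (circleMap c R θ)) (Icc 0 (2 * π)) :=
    hh.comp (continuous_circleMap c R).continuousOn fun θ _ => circleMap_mem_sphere' c R θ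
  refine mul_lt_mul_of_pos_left ?_ (inv_pos.2 Real.two_pi_pos)
  exact intervalIntegral.integral_lt_integral_of_continuousOn_of_le_of_exists_lt Real.two_pi_pos
    (hcircle hf) (hcircle hg) (fun θ _ => hle _ (circleMap_mem_sphere' c R θ))
    ⟨θ, Ioc_subset_Icc_self hθ, hfg⟩

end CircleAverage

section LpNormPow

/-- The `p`-th power `‖P‖_p ^ p` of the `L^p` norm of a polynomial on the unit circle, written as a
circle average in order to use its invariance under rotations and conjugation. -/
noncomputable def lpNormPow (p : ℝ) (P : ℂ[X]) : ℝ :=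
  Real.circleAverage (fun z => ‖P.eval z‖ ^ p) 0 1

variable {p : ℝ}

theorem continuous_norm_eval_rpow (hp : 0 ≤ p) (P : ℂ[X]) :
    Continuous fun z => ‖P.eval z‖ ^ p :=
  P.continuous.norm.rpow_const fun _ => Or.inr hp

theorem circleIntegrable_norm_eval_rpow (hp : 0 ≤ p) (P : ℂ[X]) :
    CircleIntegrable (fun z => ‖P.eval z‖ ^ p) 0 1 :=
  (continuous_norm_eval_rpow hp P).continuousOn.circleIntegrable zero_le_one

theorem lpNormPow_nonneg (p : ℝ) (P : ℂ[X]) : 0 ≤ lpNormPow p P :=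
  Real.circleAverage_nonneg_of_nonneg fun _ _ => by positivity

theorem lpNorm_rpow (hp : p ≠ 0) (P : ℂ[X]) : lpNorm p P ^ p = lpNormPow p P := by
  have h : lpNorm p P = lpNormPow p P ^ (1 / p) := by
    rw [lpNorm, lpNormPow, circleAverage_eq_integral_neg_pi_pi, intervalIntegral.integral_div,
      smul_eq_mul, div_eq_inv_mul]
    simp only [circleMap_zero, Complex.ofReal_one, one_mul]
  rw [h, ← Real.rpow_mul (lpNormPow_nonneg p P), one_div_mul_cancel hp, Real.rpow_one]

theorem lpNormPow_C_mul (c : ℂ) (P : ℂ[X]) :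
    lpNormPow p (C c * P) = ‖c‖ ^ p * lpNormPow p P := by
  simp only [lpNormPow, eval_mul, eval_C, norm_mul,
    Real.mul_rpow (norm_nonneg _) (norm_nonneg _)]
  exact Real.circleAverage_fun_smul (a := ‖c‖ ^ p)

theorem lpNormPow_comp_C_mul_X {z : ℂ} (hz : ‖z‖ = 1) (P : ℂ[X]) :
    lpNormPow p (P.comp (C z * X)) = lpNormPow p P := by
  simp only [lpNormPow, eval_comp, eval_mul, eval_C, eval_X]
  exact circleAverage_comp_mul_left hz (fun w => ‖P.eval w‖ ^ p) 1

theorem eval_map_conj (P : ℂ[X]) (z : ℂ) :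
    (P.map (starRingEnd ℂ)).eval z = conj (P.eval (conj z)) := by
  rw [← eval_map_apply, Complex.conj_conj]

theorem lpNormPow_map_conj (P : ℂ[X]) : lpNormPow p (P.map (starRingEnd ℂ)) = lpNormPow p P := by
  simp only [lpNormPow, eval_map_conj, Complex.norm_conj]
  exact circleAverage_comp_conj fun z => ‖P.eval z‖ ^ p

theorem convexOn_lpNormPow (hp : 1 ≤ p) : ConvexOn ℝ univ (lpNormPow p) := by
  have hp0 : 0 ≤ p := zero_le_one.trans hp
  refine ⟨convex_univ, fun P _ Q _ a b ha hb hab => ?_⟩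
  have hP := circleIntegrable_norm_eval_rpow hp0 P
  have hQ := circleIntegrable_norm_eval_rpow hp0 Q
  simp only [lpNormPow]
  rw [← Real.circleAverage_fun_smul, ← Real.circleAverage_fun_smul,
    ← Real.circleAverage_fun_add hP.const_fun_smul hQ.const_fun_smul]
  refine Real.circleAverage_mono (circleIntegrable_norm_eval_rpow hp0 _)
    (hP.const_smul.add hQ.const_smul) fun z _ => ?_
  have hnorm : ‖(a • P + b • Q).eval z‖ ≤ a • ‖P.eval z‖ + b • ‖Q.eval z‖ := by
    rw [eval_add, eval_smul, eval_smul]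
    exact (convexOn_norm convex_univ).2 (mem_univ _) (mem_univ _) ha hb hab
  exact (Real.rpow_le_rpow (norm_nonneg _) hnorm hp0).trans
    ((convexOn_rpow hp).2 (norm_nonneg _) (norm_nonneg _) ha hb hab)

theorem lpNormPow_lt_lpNormPow (hp : 0 < p) {P Q : ℂ[X]}
    (hle : ∀ z ∈ sphere (0 : ℂ) 1, ‖P.eval z‖ ≤ ‖Q.eval z‖)
    (hlt : ∃ z ∈ sphere (0 : ℂ) 1, ‖P.eval z‖ < ‖Q.eval z‖) : lpNormPow p P < lpNormPow p Q := by
  rw [← abs_one] at hle hlt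
  obtain ⟨z, hz, hlt⟩ := hlt
  exact circleAverage_lt_circleAverage (continuous_norm_eval_rpow hp.le P).continuousOn
    (continuous_norm_eval_rpow hp.le Q).continuousOn
    (fun w hw => Real.rpow_le_rpow (norm_nonneg _) (hle w hw) hp.le)
    ⟨z, hz, Real.rpow_lt_rpow (norm_nonneg _) hlt hp⟩

theorem infinite_unitSphere : (sphere (0 : ℂ) 1).Infinite := by
  have hrank : 1 < Module.rank ℝ ℂ := by simp [Complex.rank_real_complex]
  refine (isPreconnected_sphere hrank 0 1).infinite_of_nontrivial ⟨1, by simp, -1, by simp, ?_⟩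
  norm_num

theorem eq_of_eqOn_unitSphere {P Q : ℂ[X]} (h : ∀ z ∈ sphere (0 : ℂ) 1, P.eval z = Q.eval z) :
    P = Q :=
  eq_of_infinite_eval_eq P Q (infinite_unitSphere.mono h)

theorem lpNormPow_pos (hp : 0 < p) {P : ℂ[X]} (hP : P ≠ 0) : 0 < lpNormPow p P := by
  refine (lpNormPow_nonneg p 0).trans_lt (lpNormPow_lt_lpNormPow hp (by simp) ?_)
  by_contra! h
  exact hP (eq_of_eqOn_unitSphere fun z hz => by simpa using h z hz)

end LpNormPow

section Homogeneous

open Filter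

variable {E : Type*} [NormedAddCommGroup E] [NormedSpace ℝ E] [ProperSpace E] {N : E → ℝ} {p : ℝ}

theorem exists_pos_mul_norm_rpow_le (hN : Continuous N) (hpos : ∀ x ≠ 0, 0 < N x)
    (hsmul : ∀ c > 0, ∀ x, N (c • x) = c ^ p * N x) :
    ∃ m > 0, ∀ x ≠ 0, m * ‖x‖ ^ p ≤ N x := by
  obtain ⟨m, hm, hle⟩ := (isCompact_sphere (0 : E) 1).exists_forall_le' hN.continuousOn
    fun x hx => hpos x (ne_zero_of_mem_unit_sphere ⟨x, hx⟩)
  refine ⟨m, hm, fun x hx => ?_⟩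
  have hx0 : 0 < ‖x‖ := norm_pos_iff.2 hx
  have hunit : ‖x‖⁻¹ • x ∈ sphere (0 : E) 1 := by
    rw [mem_sphere_zero_iff_norm, norm_smul, norm_inv, norm_norm, inv_mul_cancel₀ hx0.ne']
  calc m * ‖x‖ ^ p ≤ N (‖x‖⁻¹ • x) * ‖x‖ ^ p := by gcongr; exact hle _ hunit
    _ = N (‖x‖ • ‖x‖⁻¹ • x) := by rw [hsmul _ hx0, mul_comm]
    _ = N x := by rw [smul_inv_smul₀ hx0.ne']

theorem exists_isMinOn_of_homogeneous (hp : 0 < p) (hN : Continuous N)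
    (hpos : ∀ x ≠ 0, 0 < N x) (hsmul : ∀ c > 0, ∀ x, N (c • x) = c ^ p * N x) {s : Set E}
    (hs : IsClosed s) (hne : s.Nonempty) : ∃ x ∈ s, IsMinOn N s x := by
  obtain ⟨m, hm, hle⟩ := exists_pos_mul_norm_rpow_le hN hpos hsmul
  have hnorm : Tendsto (norm : E → ℝ) (cocompact E) atTop := tendsto_norm_cocompact_atTop
  have htend : Tendsto N (cocompact E) atTop :=
    tendsto_atTop_mono'
      _ ((hnorm.eventually_gt_atTop 0).mono fun x hx => hle x (norm_pos_iff.1 hx))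
      (((tendsto_rpow_atTop hp).comp hnorm).const_mul_atTop hm)
  obtain ⟨x₀, hx₀⟩ := hne
  exact hN.continuousOn.exists_isMinOn' hs hx₀
    ((htend.eventually_ge_atTop (N x₀)).filter_mono inf_le_left)

end Homogeneous

section Extremal

variable {d : ℕ} {p : ℝ} {φ : ℂ[X]}

theorem isExtremal_iff (hp : p ≠ 0) :
    IsExtremal d p φ ↔ φ.natDegree ≤ d ∧ φ.eval 1 = 1 ∧
      ∀ P : ℂ[X], P.natDegree ≤ d → P.eval 1 = 1 → lpNormPow p φ ≤ lpNormPow p P := by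
  simp only [← lpNorm_rpow hp]
  exact ⟨fun ⟨hdeg, hone, hle⟩ => ⟨hdeg, hone, hle⟩, fun ⟨hdeg, hone, hle⟩ => ⟨hdeg, hone, hle⟩⟩

theorem eval_degreeLTEquiv_symm {R : Type*} [Semiring R] {n : ℕ} (a : Fin n → R) (x : R) :
    ((degreeLTEquiv R n).symm a : R[X]).eval x = ∑ i, a i * x ^ (i : ℕ) := by
  rw [eval_eq_sum_degreeLTEquiv (SetLike.coe_mem _), Subtype.coe_eta, LinearEquiv.apply_symm_apply]

theorem natDegree_le_iff_mem_degreeLT {R : Type*} [Semiring R] {n : ℕ} {P : R[X]} :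
    P.natDegree ≤ n ↔ P ∈ degreeLT R (n + 1) := by
  rw [degreeLT_succ_eq_degreeLE, mem_degreeLE, natDegree_le_iff_degree_le]

theorem continuous_lpNormPow_degreeLTEquiv_symm (hp : 0 ≤ p) (n : ℕ) :
    Continuous fun a : Fin n → ℂ => lpNormPow p ((degreeLTEquiv ℂ n).symm a : ℂ[X]) := by
  simp only [lpNormPow, eval_degreeLTEquiv_symm, Real.circleAverage_def]
  refine (intervalIntegral.continuous_parametric_intervalIntegral_of_continuous'
    (μ := volume) ?_ 0 (2 * π)).const_smul (2 * π)⁻¹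
  exact Continuous.rpow_const (by fun_prop) fun _ => Or.inr hp

theorem exists_isExtremal (hp : 0 < p) (d : ℕ) : ∃ φ, IsExtremal d p φ := by
  let e := (degreeLTEquiv ℂ (d + 1)).symm
  let N : (Fin (d + 1) → ℂ) → ℝ := fun a => lpNormPow p (e a : ℂ[X])
  have hpos : ∀ a ≠ 0, 0 < N a := fun a ha => lpNormPow_pos hp (by simpa using ha)
  have hsmul : ∀ c > 0, ∀ a, N (c • a) = c ^ p * N a := by
    intro c hc a
    have h : (e (c • a) : ℂ[X]) = C (c : ℂ) * (e a : ℂ[X]) := by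
      rw [C_mul', ← Submodule.coe_smul, ← map_smul, Complex.coe_smul]
    simp only [N, h, lpNormPow_C_mul, Complex.norm_real, Real.norm_of_nonneg hc.le]
  have hclosed : IsClosed {a | (e a : ℂ[X]).eval 1 = 1} := by
    simp only [e, eval_degreeLTEquiv_symm]
    exact isClosed_eq (by fun_prop) continuous_const
  have hne : {a | (e a : ℂ[X]).eval 1 = 1}.Nonempty :=
    ⟨e.symm ⟨1, natDegree_le_iff_mem_degreeLT.1 (by simp)⟩, by simp⟩
  obtain ⟨a, ha, hmin⟩ := exists_isMinOn_of_homogeneous hp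
    (continuous_lpNormPow_degreeLTEquiv_symm hp.le _) hpos hsmul hclosed hne
  refine ⟨e a, (isExtremal_iff hp.ne').2
    ⟨natDegree_le_iff_mem_degreeLT.2 (e a).2, ha, fun P hP hone => ?_⟩⟩
  have hle : N a ≤ N (e.symm ⟨P, natDegree_le_iff_mem_degreeLT.1 hP⟩) := hmin (by simpa using hone)
  rwa [show N (e.symm _) = lpNormPow p P by simp only [N, LinearEquiv.apply_symm_apply]] at hle

theorem exists_isExtremal_map_conj_eq (hp : 1 ≤ p) (d : ℕ) :
    ∃ φ, IsExtremal d p φ ∧ φ.map (starRingEnd ℂ) = φ := by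
  have hp0 : 0 < p := zero_lt_one.trans_le hp
  obtain ⟨φ, hφ⟩ := exists_isExtremal hp0 d
  obtain ⟨hdeg, hone, hle⟩ := (isExtremal_iff hp0.ne').1 hφ
  set ψ := φ.map (starRingEnd ℂ) with hψ
  have hdegψ : ψ.natDegree ≤ d := natDegree_map_le.trans hdeg
  refine ⟨(1 / 2 : ℝ) • φ + (1 / 2 : ℝ) • ψ, (isExtremal_iff hp0.ne').2 ⟨?_, ?_, ?_⟩, ?_⟩
  · exact natDegree_add_le_of_degree_le ((natDegree_smul_le _ _).trans hdeg)
      ((natDegree_smul_le _ _).trans hdegψ)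
  · rw [eval_add, eval_smul, eval_smul, hψ, eval_map_conj, map_one, hone, map_one, ← add_smul]
    norm_num
  · intro P hP hP1
    calc lpNormPow p ((1 / 2 : ℝ) • φ + (1 / 2 : ℝ) • ψ)
        ≤ (1 / 2 : ℝ) • lpNormPow p φ + (1 / 2 : ℝ) • lpNormPow p ψ :=
          (convexOn_lpNormPow hp).2 (mem_univ φ) (mem_univ ψ) one_half_pos.le one_half_pos.le
            (add_halves 1)
      _ = lpNormPow p φ := by rw [hψ, lpNormPow_map_conj, ← add_smul, add_halves, one_smul]
      _ ≤ lpNormPow p P := hle P hP hP1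
  · ext n
    simp [hψ, add_comm, map_ofNat]

namespace IsExtremal

theorem ne_zero (h : IsExtremal d p φ) : φ ≠ 0 := by
  rintro rfl
  simpa using h.eval_one

theorem norm_eval_rpow_le (hp : 0 < p) (h : IsExtremal d p φ) {P : ℂ[X]} (hP : P.natDegree ≤ d)
    {z : ℂ} (hz : ‖z‖ = 1) : ‖P.eval z‖ ^ p ≤ (lpNormPow p φ)⁻¹ * lpNormPow p P := by
  have hφ : 0 < lpNormPow p φ := lpNormPow_pos hp h.ne_zero
  rcases eq_or_ne (P.eval z) 0 with h0 | h0
  · rw [h0, norm_zero, Real.zero_rpow hp.ne']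
    exact mul_nonneg (inv_nonneg.2 hφ.le) (lpNormPow_nonneg p P)
  have hv : 0 < ‖P.eval z‖ ^ p := Real.rpow_pos_of_pos (norm_pos_iff.2 h0) p
  have hdeg : (C (P.eval z)⁻¹ * P.comp (C z * X)).natDegree ≤ d := by
    refine (natDegree_C_mul_le _ _).trans (natDegree_comp_le.trans ?_)
    exact (Nat.mul_le_mul hP ((natDegree_C_mul_le _ _).trans natDegree_X_le)).trans_eq (mul_one d)
  have hone : (C (P.eval z)⁻¹ * P.comp (C z * X)).eval 1 = 1 := by
    simp [inv_mul_cancel₀ h0]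
  have hle := ((isExtremal_iff hp.ne').1 h).2.2 _ hdeg hone
  rw [lpNormPow_C_mul, lpNormPow_comp_C_mul_X hz, norm_inv, Real.inv_rpow (norm_nonneg _),
    le_inv_mul_iff₀ hv] at hle
  rwa [le_inv_mul_iff₀ hφ, mul_comm]

theorem supNorm_rpow_le (hp : 0 < p) (h : IsExtremal d p φ) {P : ℂ[X]} (hP : P.natDegree ≤ d) :
    supNorm P ^ p ≤ (lpNormPow p φ)⁻¹ * lpNormPow p P := by
  have hbound : 0 ≤ (lpNormPow p φ)⁻¹ * lpNormPow p P :=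
    mul_nonneg (inv_nonneg.2 (lpNormPow_nonneg p φ)) (lpNormPow_nonneg p P)
  have hsup : 0 ≤ supNorm P := Real.iSup_nonneg fun _ => norm_nonneg _
  rw [← Real.le_rpow_inv_iff_of_pos hsup hbound hp]
  refine ciSup_le fun z => ?_
  rw [Real.le_rpow_inv_iff_of_pos (norm_nonneg _) hbound hp]
  exact h.norm_eval_rpow_le hp hP z.norm_coe

theorem nikolskiiConst_le (hp : 0 < p) (h : IsExtremal d p φ) :
    nikolskiiConst d p ≤ (lpNormPow p φ)⁻¹ := by
  refine csInf_le ⟨0, fun c hc => ?_⟩ fun P hP => ?_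
  · have hone := hc 1 (by simp)
    rw [lpNorm_rpow hp.ne'] at hone
    have hsup : 0 ≤ supNorm 1 ^ p := Real.rpow_nonneg (Real.iSup_nonneg fun _ => norm_nonneg _) p
    exact nonneg_of_mul_nonneg_left (hsup.trans hone) (lpNormPow_pos hp one_ne_zero)
  · rw [lpNorm_rpow hp.ne']
    exact h.supNorm_rpow_le hp hP

end IsExtremal

end Extremal

namespace IsExtremal

variable {d : ℕ} {p : ℝ} {φ Q : ℂ[X]}

-- Otherwise strict convexity makes the midpoint of `φ` and `Q` smaller than `φ`.
theorem eq_of_norm_eval_eq (hp : 0 < p) (h : IsExtremal d p φ) (hdeg : Q.natDegree ≤ d)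
    (hone : Q.eval 1 = 1) (hnorm : ∀ z ∈ sphere (0 : ℂ) 1, ‖φ.eval z‖ = ‖Q.eval z‖) : φ = Q := by
  by_contra hne
  have hmid (z : ℂ) : ((1 / 2 : ℝ) • (φ + Q)).eval z = (1 / 2 : ℝ) • (φ.eval z + Q.eval z) := by
    rw [eval_smul, eval_add]
  have hlt : lpNormPow p ((1 / 2 : ℝ) • (φ + Q)) < lpNormPow p φ := by
    refine lpNormPow_lt_lpNormPow hp (fun z hz => ?_) ?_
    · rw [hmid]
      have hle : ‖φ.eval z + Q.eval z‖ ≤ ‖φ.eval z‖ + ‖φ.eval z‖ :=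
        norm_add_le_of_le le_rfl (hnorm z hz).ge
      rw [norm_smul, Real.norm_of_nonneg one_half_pos.le]
      linarith
    · by_contra! hle
      refine hne (eq_of_eqOn_unitSphere fun z hz => ?_)
      by_contra hz0
      exact (hle z hz).not_gt (hmid z ▸ (norm_midpoint_lt_iff (hnorm z hz)).2 hz0)
  refine hlt.not_ge (((isExtremal_iff hp.ne').1 h).2.2 _ ?_ ?_)
  · exact (natDegree_smul_le _ _).trans (natDegree_add_le_of_degree_le h.natDegree_le hdeg)
  · rw [hmid, h.eval_one, hone]
    norm_num

theorem natDegree_eq (hp : 0 < p) (h : IsExtremal d p φ) : φ.natDegree = d := by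
  refine h.natDegree_le.eq_or_lt.resolve_right fun hlt => ?_
  have hX : φ = X * φ := by
    refine h.eq_of_norm_eval_eq hp ?_ (by simp [h.eval_one]) fun z hz => ?_
    · rwa [natDegree_X_mul h.ne_zero]
    · simp [mem_sphere_zero_iff_norm.1 hz]
  have hXdeg := congrArg natDegree hX
  rw [natDegree_X_mul h.ne_zero] at hXdeg
  omega

theorem not_isRoot_one (h : IsExtremal d p φ) : ¬ φ.IsRoot 1 := by
  rw [IsRoot, h.eval_one]
  exact one_ne_zero

-- Replacing a factor `X - w` by the reflected factor `1 - w̄ X`, of the same modulus on the circle,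
-- yields another extremal polynomial.
theorem norm_eq_one_of_isRoot (hp : 0 < p) (h : IsExtremal d p φ) {w : ℂ} (hw : φ.IsRoot w) :
    ‖w‖ = 1 := by
  obtain ⟨ψ, rfl⟩ := dvd_iff_isRoot.2 hw
  have hψ : ψ ≠ 0 := right_ne_zero_of_mul h.ne_zero
  have hw1 : 1 - w ≠ 0 := fun h1 => h.not_isRoot_one (sub_eq_zero.1 h1 ▸ hw)
  have hw1' : 1 - conj w ≠ 0 := fun h1 => hw1 (by simpa using congrArg conj h1)
  set c : ℂ := (1 - w) / (1 - conj w) with hc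
  have hcnorm : ‖c‖ = 1 := by
    rw [hc, norm_div, ← Complex.norm_conj (1 - w), map_sub, map_one,
      div_self (norm_ne_zero_iff.2 hw1')]
  have hreflect : (X - C w) * ψ = C c * (1 - C (conj w) * X) * ψ := by
    refine h.eq_of_norm_eval_eq hp ?_ ?_ fun z hz => ?_
    · have hdeg : (C c * (1 - C (conj w) * X)).natDegree ≤ 1 := by
        compute_degree
      refine natDegree_mul_le.trans ((Nat.add_le_add_right hdeg _).trans ?_)
      rw [← natDegree_X_sub_C w, ← (monic_X_sub_C w).natDegree_mul' hψ]
      exact h.natDegree_le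
    · have hone : (1 - w) * ψ.eval 1 = 1 := by simpa using h.eval_one
      simp [hc, div_mul_cancel₀ _ hw1', hone]
    · have hzw : 1 - conj w * z = z * conj (z - w) := by
        rw [map_sub, mul_sub, Complex.mul_conj']
        rw [mem_sphere_zero_iff_norm.1 hz]
        push_cast
        ring
      simp [hcnorm, hzw, mem_sphere_zero_iff_norm.1 hz, -map_sub]
  have hwz := congrArg (eval w) (mul_right_cancel₀ hψ hreflect)
  have hc0 : c ≠ 0 := norm_ne_zero_iff.1 (hcnorm ▸ one_ne_zero)
  have hnorm : conj w * w = 1 := by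
    simpa [hc0, sub_eq_zero, eq_comm (b := conj w * w)] using hwz.symm
  rw [Complex.conj_mul'] at hnorm
  exact (pow_eq_one_iff_of_nonneg (norm_nonneg w) two_ne_zero).1 (by exact_mod_cast hnorm)

end IsExtremal

/-- The monic quadratic polynomial with zeros `e^{± i s}`. -/
noncomputable def zeroPair (s : ℝ) : ℂ[X] :=
  (X - C (Complex.exp (s * Complex.I))) * (X - C (Complex.exp (-(s * Complex.I))))

section ZeroPair

theorem zeroPair_abs (s : ℝ) : zeroPair |s| = zeroPair s := by
  rcases abs_choice s with h | h
  · rw [h]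
  · rw [h, zeroPair, zeroPair, mul_comm, Complex.ofReal_neg, neg_mul, neg_neg]

theorem zeroPair_arg {w : ℂ} (hw : ‖w‖ = 1) :
    zeroPair w.arg = (X - C w) * (X - C (conj w)) := by
  have h : Complex.exp (w.arg * Complex.I) = w := by
    simpa [hw] using Complex.norm_mul_exp_arg_mul_I w
  rw [zeroPair, Complex.exp_neg, h, Complex.inv_eq_conj hw]

theorem zeroPair_pi : zeroPair π = (X + 1) ^ 2 := by
  rw [zeroPair, Complex.exp_neg, Complex.exp_pi_mul_I, inv_neg, inv_one, C_neg, C_1, sub_neg_eq_add,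
    sq]

theorem monic_zeroPair (s : ℝ) : (zeroPair s).Monic :=
  (monic_X_sub_C _).mul (monic_X_sub_C _)

theorem natDegree_zeroPair (s : ℝ) : (zeroPair s).natDegree = 2 := by
  rw [zeroPair, (monic_X_sub_C _).natDegree_mul (monic_X_sub_C _), natDegree_X_sub_C,
    natDegree_X_sub_C]

theorem zeroPair_map_conj (s : ℝ) : (zeroPair s).map (starRingEnd ℂ) = zeroPair s := by
  simp [zeroPair, ← Complex.exp_conj, mul_comm]

theorem eq_neg_one_of_conj_eq_self {w : ℂ} (hw : ‖w‖ = 1) (hne : w ≠ 1) (hconj : conj w = w) :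
    w = -1 := by
  refine (mul_self_eq_one_iff.1 ?_).resolve_left hne
  have h := Complex.conj_mul' w
  rwa [hconj, hw, Complex.ofReal_one, one_pow] at h

variable {φ ψ A : ℂ[X]}

theorem map_conj_eq_of_mul (hA : A ≠ 0) (hAconj : A.map (starRingEnd ℂ) = A)
    (hconj : (A * ψ).map (starRingEnd ℂ) = A * ψ) : ψ.map (starRingEnd ℂ) = ψ := by
  rw [Polynomial.map_mul, hAconj] at hconj
  exact mul_left_cancel₀ hA hconj

theorem zeroPair_arg_dvd (hconj : φ.map (starRingEnd ℂ) = φ) {w : ℂ} (hw : ‖w‖ = 1)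
    (hroot : φ.IsRoot w) (hne : conj w ≠ w) : zeroPair w.arg ∣ φ := by
  have hroot' : φ.IsRoot (conj w) := by
    rw [IsRoot, ← hconj, eval_map_apply, hroot.eq_zero, map_zero]
  rw [zeroPair_arg hw]
  exact (isCoprime_X_sub_C_of_isUnit_sub (sub_ne_zero.2 hne.symm).isUnit).mul_dvd
    (dvd_iff_isRoot.2 hroot) (dvd_iff_isRoot.2 hroot')

theorem exists_zeroPair_dvd (hconj : φ.map (starRingEnd ℂ) = φ)
    (hroot : ∀ w, φ.IsRoot w → ‖w‖ = 1 ∧ w ≠ 1) (hdeg : 2 ≤ φ.natDegree) :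
    ∃ s ∈ Icc 0 π, zeroPair s ∣ φ := by
  have hpair {w : ℂ} : zeroPair w.arg ∣ φ → ∃ s ∈ Icc 0 π, zeroPair s ∣ φ := fun h =>
    ⟨|w.arg|, ⟨abs_nonneg _, Complex.abs_arg_le_pi w⟩, zeroPair_abs w.arg ▸ h⟩
  obtain ⟨w, hw⟩ := Complex.exists_root (natDegree_pos_iff_degree_pos.1 (two_pos.trans_le hdeg))
  by_cases hwc : conj w = w
  swap
  · exact hpair (zeroPair_arg_dvd hconj (hroot w hw).1 hw hwc)
  obtain rfl := eq_neg_one_of_conj_eq_self (hroot w hw).1 (hroot w hw).2 hwc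
  obtain ⟨ψ, rfl⟩ := dvd_iff_isRoot.2 hw
  have hψdeg : 0 < ψ.natDegree := by
    have := natDegree_mul_le (p := X - C (-1 : ℂ)) (q := ψ)
    rw [natDegree_X_sub_C] at this
    omega
  have hψconj : ψ.map (starRingEnd ℂ) = ψ :=
    map_conj_eq_of_mul (X_sub_C_ne_zero _) (by simp) hconj
  obtain ⟨v, hv⟩ := Complex.exists_root (natDegree_pos_iff_degree_pos.1 hψdeg)
  have hvroot := hroot v (root_mul_left_of_isRoot _ hv)
  by_cases hvc : conj v = v
  · obtain rfl := eq_neg_one_of_conj_eq_self hvroot.1 hvroot.2 hvc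
    refine ⟨π, ⟨Real.pi_pos.le, le_rfl⟩, ?_⟩
    rw [zeroPair_pi, sq]
    simpa using mul_dvd_mul_left (X + 1) (dvd_iff_isRoot.2 hv)
  · exact hpair ((zeroPair_arg_dvd hψconj hvroot.1 hv hvc).mul_left _)

theorem eq_C_mul_X_add_one_pow {r : ℕ} (hr : r < 2) (hconj : φ.map (starRingEnd ℂ) = φ)
    (hroot : ∀ w, φ.IsRoot w → ‖w‖ = 1 ∧ w ≠ 1) (hdeg : φ.natDegree = r) :
    φ = C φ.leadingCoeff * (X + 1) ^ r := by
  rcases Nat.le_one_iff_eq_zero_or_eq_one.1 (Nat.lt_succ_iff.1 hr) with rfl | rfl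
  · rw [pow_zero, mul_one, leadingCoeff, hdeg]
    exact eq_C_of_natDegree_eq_zero hdeg
  obtain ⟨w, hw⟩ := Complex.exists_root (natDegree_pos_iff_degree_pos.1 (hdeg ▸ one_pos))
  have hwc : conj w = w := by
    by_contra hne
    have hφ : φ ≠ 0 := ne_zero_of_natDegree_gt (hdeg ▸ one_pos)
    have hle := natDegree_le_of_dvd (zeroPair_arg_dvd hconj (hroot w hw).1 hw hne) hφ
    rw [natDegree_zeroPair] at hle
    omega
  obtain rfl := eq_neg_one_of_conj_eq_self (hroot w hw).1 (hroot w hw).2 hwc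
  have hlin := eq_X_add_C_of_natDegree_le_one hdeg.le
  have hcoeff : φ.coeff 1 = φ.coeff 0 := by
    have h0 := hw.eq_zero
    rw [hlin, eval_add, eval_mul, eval_C, eval_C, eval_X, mul_neg_one] at h0
    exact neg_add_eq_zero.1 h0
  rw [leadingCoeff, hdeg, pow_one, mul_add, mul_one]
  rwa [← hcoeff] at hlin

theorem exists_eq_prod_zeroPair {r : ℕ} (hr : r < 2) (k : ℕ) (hconj : φ.map (starRingEnd ℂ) = φ)
    (hroot : ∀ w, φ.IsRoot w → ‖w‖ = 1 ∧ w ≠ 1) (hdeg : φ.natDegree = 2 * k + r) :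
    ∃ s : Fin k → ℝ, (∀ j, s j ∈ Icc 0 π) ∧
      φ = C φ.leadingCoeff * (X + 1) ^ r * ∏ j, zeroPair (s j) := by
  induction k generalizing φ with
  | zero =>
    refine ⟨Fin.elim0, fun j => j.elim0, ?_⟩
    rw [Fin.prod_univ_zero, mul_one]
    exact eq_C_mul_X_add_one_pow hr hconj hroot (by omega)
  | succ k ih =>
    obtain ⟨σ, hσ, ψ, rfl⟩ := exists_zeroPair_dvd hconj hroot (by omega)
    have hψ : ψ ≠ 0 := by
      rintro rfl
      rw [mul_zero, natDegree_zero] at hdeg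
      omega
    obtain ⟨s, hs, hprod⟩ := ih
      (map_conj_eq_of_mul (monic_zeroPair σ).ne_zero (zeroPair_map_conj σ) hconj)
      (fun w hw => hroot w (root_mul_left_of_isRoot _ hw)) (by
        rw [(monic_zeroPair σ).natDegree_mul' hψ, natDegree_zeroPair] at hdeg
        omega)
    refine ⟨Fin.cons σ s, Fin.cases hσ hs, ?_⟩
    rw [Fin.prod_univ_succ, leadingCoeff_monic_mul (monic_zeroPair σ)]
    simp only [Fin.cons_zero, Fin.cons_succ]
    conv_lhs => rw [hprod]
    ring

end ZeroPair

theorem monotone_snoc {α : Type*} [Preorder α] {n : ℕ} {s : Fin n → α} {a : α} (hs : Monotone s)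
    (ha : ∀ i, s i ≤ a) : Monotone (Fin.snoc s a : Fin (n + 1) → α) := by
  intro i j hij
  induction j using Fin.lastCases with
  | last =>
    induction i using Fin.lastCases with
    | last => rfl
    | cast i => simpa using ha i
  | cast j =>
    induction i using Fin.lastCases with
    | last => exact absurd hij (Fin.castSucc_lt_last j).not_ge
    | cast i => simpa using hs (by simpa using hij)

theorem exists_mem_T_hasZeroArgs {d : ℕ} {φ : ℂ[X]} (hdeg : φ.natDegree = d) (h0 : φ ≠ 0)
    (hconj : φ.map (starRingEnd ℂ) = φ) (hroot : ∀ w, φ.IsRoot w → ‖w‖ = 1 ∧ w ≠ 1) :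
    ∃ t ∈ T d, HasZeroArgs d φ t := by
  obtain ⟨s, hs, hprod⟩ := exists_eq_prod_zeroPair (Nat.mod_lt d two_pos) (d / 2) hconj hroot
    (by rw [hdeg, Nat.div_add_mod])
  let s' : Fin (d / 2) → ℝ := s ∘ Tuple.sort s
  let t : Fin (d / 2 + 2) → ℝ := Matrix.vecCons 0 (Fin.snoc s' π)
  have hmono : Monotone t := by
    refine monotone_vecCons.2 ⟨?_, monotone_snoc (Tuple.monotone_sort s) fun j => (hs _).2⟩
    have hsnoc : ∀ i, 0 ≤ (Fin.snoc s' π : Fin (d / 2 + 1) → ℝ) i :=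
      Fin.lastCases (by simpa using Real.pi_pos.le) fun j => by simpa [s'] using (hs _).1
    exact hsnoc 0
  have ht (j : Fin (d / 2)) : t j.succ.castSucc = s' j := by
    simp [t]
  refine ⟨t, ⟨hmono, rfl, ?_⟩, φ.leadingCoeff, leadingCoeff_ne_zero.2 h0, ?_⟩
  · simp [t, ← Fin.succ_last]
  · simp only [ht]
    conv_lhs => rw [hprod, ← Equiv.prod_comp (Tuple.sort s)]
    rfl

section Cauchy

variable {f : ℂ → ℂ}

theorem diffContOnCl_dslope {E : Type*} [NormedAddCommGroup E] [NormedSpace ℂ E] {f : ℂ → E}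
    {s : Set ℂ} {w : ℂ} (hf : DiffContOnCl ℂ f s) (hw : w ∉ s) (hfw : DifferentiableAt ℂ f w) :
    DiffContOnCl ℂ (dslope f w) s := by
  refine ⟨(differentiableOn_dslope_of_notMem hw).2 hf.differentiableOn, fun z hz => ?_⟩
  rcases eq_or_ne z w with rfl | hne
  · exact (continuousAt_dslope_same.2 hfw).continuousWithinAt
  · exact (continuousWithinAt_dslope_of_ne hne).2 (hf.continuousOn z hz)

theorem continuousOn_mul_dslope_one (hf : DiffContOnCl ℂ f (ball 0 1))
    (hf1 : DifferentiableAt ℂ f 1) :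
    ContinuousOn (fun z => z * dslope f 1 z) (sphere 0 1) := by
  have h := (diffContOnCl_dslope hf (by simp) hf1).continuousOn
  rw [closure_ball _ one_ne_zero] at h
  exact continuousOn_id.mul (h.mono sphere_subset_closedBall)

theorem circleAverage_mul_dslope_one (hf : DiffContOnCl ℂ f (ball 0 1))
    (hf1 : DifferentiableAt ℂ f 1) :
    Real.circleAverage (fun z => z * dslope f 1 z) 0 1 = 0 := by
  have h : DiffContOnCl ℂ (fun z => z * dslope f 1 z) (ball 0 |1|) := by
    rw [abs_one]
    exact differentiable_id.diffContOnCl.smul (diffContOnCl_dslope hf (by simp) hf1)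
  rw [h.circleAverage, zero_mul]

theorem dslope_one_conj (hconj : ∀ z ∈ sphere (0 : ℂ) 1, f (conj z) = conj (f z)) {z : ℂ}
    (hz : z ∈ sphere (0 : ℂ) 1) (hne : z ≠ 1) :
    dslope f 1 (conj z) = conj (dslope f 1 z) := by
  have hne' : conj z ≠ 1 := fun h => hne (by simpa using congrArg conj h)
  have hone := hconj 1 (by simp)
  rw [map_one] at hone
  rw [dslope_of_ne _ hne, dslope_of_ne _ hne', slope_def_field, slope_def_field, hconj z hz,
    map_div₀, map_sub, map_sub, map_one, ← hone]

theorem integral_re_mul_dslope_one (hf : DiffContOnCl ℂ f (ball 0 1))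
    (hf1 : DifferentiableAt ℂ f 1)
    (hconj : ∀ z ∈ sphere (0 : ℂ) 1, f (conj z) = conj (f z)) :
    ∫ θ in 0..π, (circleMap 0 1 θ * dslope f 1 (circleMap 0 1 θ)).re = 0 := by
  have hint := (continuousOn_mul_dslope_one hf hf1).circleIntegrable zero_le_one
  have hre : CircleIntegrable (fun z => (z * dslope f 1 z).re) 0 1 :=
    (Complex.continuous_re.comp_continuousOn
      (continuousOn_mul_dslope_one hf hf1)).circleIntegrable zero_le_one
  rw [integral_zero_pi_circleMap hre fun z hz => ?_]
  · have h := Complex.reCLM.circleAverage_comp_comm hint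
    rw [circleAverage_mul_dslope_one hf hf1, map_zero] at h
    exact (congrArg (π • ·) h).trans (smul_zero π)
  · rcases eq_or_ne z 1 with rfl | hne
    · rw [map_one]
    · rw [dslope_one_conj hconj hz hne, ← map_mul, Complex.conj_re]

theorem circleMap_zero_one_zero : circleMap 0 1 0 = 1 := by simp [circleMap_zero]

theorem circleMap_zero_one_add (α β : ℝ) :
    circleMap 0 1 (α + β) = circleMap 0 1 α * circleMap 0 1 β := by
  simp [circleMap_zero, add_mul, Complex.exp_add]

theorem circleMap_zero_one_sub_one (θ : ℝ) :
    circleMap 0 1 θ - 1 = 2 * Complex.I * Real.sin (θ / 2) * circleMap 0 1 (θ / 2) := by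
  have hinv : circleMap 0 1 (-(θ / 2)) * circleMap 0 1 (θ / 2) = 1 := by
    rw [← circleMap_zero_one_add, neg_add_cancel, circleMap_zero_one_zero]
  have hsin : 2 * Complex.I * Real.sin (θ / 2) =
      circleMap 0 1 (θ / 2) - circleMap 0 1 (-(θ / 2)) := by
    simp only [Complex.ofReal_sin, Complex.sin, circleMap_zero, Complex.ofReal_one, one_mul,
      Complex.ofReal_neg]
    linear_combination (Complex.exp (-(θ / 2 : ℝ) * Complex.I) -
      Complex.exp ((θ / 2 : ℝ) * Complex.I)) * Complex.I_sq
  rw [hsin, sub_mul, hinv, ← circleMap_zero_one_add, add_halves]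

theorem sin_half_pos {θ : ℝ} (hθ : θ ∈ Ioc 0 π) : 0 < Real.sin (θ / 2) :=
  Real.sin_pos_of_pos_of_lt_pi (half_pos hθ.1) ((half_lt_self hθ.1).trans_le hθ.2)

theorem circleMap_zero_one_ne_one {θ : ℝ} (hθ : Real.sin (θ / 2) ≠ 0) : circleMap 0 1 θ ≠ 1 := by
  rw [← sub_ne_zero, circleMap_zero_one_sub_one]
  exact mul_ne_zero (mul_ne_zero (mul_ne_zero two_ne_zero Complex.I_ne_zero)
    (Complex.ofReal_ne_zero.2 hθ)) (circleMap_ne_center one_ne_zero)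

theorem im_mul_circleMap_half_div_sin_half (hone : (f 1).im = 0) {θ : ℝ}
    (hθ : Real.sin (θ / 2) ≠ 0) :
    (f (circleMap 0 1 θ) * circleMap 0 1 (θ / 2)).im / Real.sin (θ / 2) =
      2 * (circleMap 0 1 θ * dslope f 1 (circleMap 0 1 θ)).re + (f 1).re := by
  set z := circleMap 0 1 θ with hz
  set E := circleMap 0 1 (θ / 2) with hE
  set s := Real.sin (θ / 2) with hs
  have hs' : (s : ℂ) ≠ 0 := Complex.ofReal_ne_zero.2 hθ
  have hE0 : E ≠ 0 := circleMap_ne_center one_ne_zero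
  have hsub : z - 1 = 2 * Complex.I * s * E := circleMap_zero_one_sub_one θ
  have hne : z ≠ 1 := circleMap_zero_one_ne_one hθ
  have hsq : z = E * E := by rw [hz, hE, ← circleMap_zero_one_add, add_halves]
  have him : E.im = s := by
    rw [hE, hs, circleMap_zero, Complex.ofReal_one, one_mul, Complex.exp_ofReal_mul_I_im]
  have hslope : 2 * (z * dslope f 1 z) = -Complex.I * ((f z - f 1) * E) * (s⁻¹ : ℝ) := by
    rw [dslope_of_ne _ hne, slope_def_field, hsub, Complex.ofReal_inv]
    generalize f z - f 1 = w
    rw [hsq]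
    field_simp
    linear_combination w * Complex.I_sq
  have hre := congrArg Complex.re hslope
  rw [Complex.re_mul_ofReal, neg_mul, Complex.neg_re, Complex.I_mul_re, neg_neg, sub_mul,
    Complex.sub_im, Complex.mul_im (f 1), hone, zero_mul, add_zero, him] at hre
  rw [show (2 : ℂ) = (2 : ℝ) by norm_num, Complex.re_ofReal_mul] at hre
  rw [hre]
  field_simp
  ring

-- Cauchy's formula at the boundary point `1`, folded onto the upper half circle by symmetry.
theorem integral_im_mul_circleMap_half_div_sin_half (hf : DiffContOnCl ℂ f (ball 0 1))
    (hf1 : DifferentiableAt ℂ f 1)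
    (hconj : ∀ z ∈ sphere (0 : ℂ) 1, f (conj z) = conj (f z)) :
    ∫ θ in 0..π, (f (circleMap 0 1 θ) * circleMap 0 1 (θ / 2)).im / Real.sin (θ / 2) =
      π * (f 1).re := by
  have hone : (f 1).im = 0 := by
    have h := hconj 1 (by simp)
    rw [map_one, eq_comm, Complex.conj_eq_iff_im] at h
    exact h
  have hcont : Continuous fun θ => (circleMap 0 1 θ * dslope f 1 (circleMap 0 1 θ)).re :=
    Complex.continuous_re.comp ((continuousOn_mul_dslope_one hf hf1).comp_continuous
      (continuous_circleMap 0 1) (circleMap_mem_sphere 0 zero_le_one))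
  calc ∫ θ in 0..π, (f (circleMap 0 1 θ) * circleMap 0 1 (θ / 2)).im / Real.sin (θ / 2)
      = ∫ θ in 0..π, (2 * (circleMap 0 1 θ * dslope f 1 (circleMap 0 1 θ)).re + (f 1).re) :=
        intervalIntegral.integral_congr_Ioo_of_le Real.pi_pos.le fun θ hθ =>
          im_mul_circleMap_half_div_sin_half hone (sin_half_pos (Ioo_subset_Ioc_self hθ)).ne'
    _ = π * (f 1).re := by
        rw [intervalIntegral.integral_add ((hcont.const_mul 2).intervalIntegrable _ _)
          intervalIntegrable_const, intervalIntegral.integral_const_mul,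
          integral_re_mul_dslope_one hf hf1 hconj, intervalIntegral.integral_const, smul_eq_mul,
          mul_zero, zero_add, sub_zero]

end Cauchy

/-- `α` is an argument of `x`, not necessarily the principal one; if `x = 0`, then every real
number is an argument of `x`. -/
def HasPhase (x : ℂ) (α : ℝ) : Prop := x = ‖x‖ * circleMap 0 1 α

namespace HasPhase

variable {x y : ℂ} {α β : ℝ}

theorem mul (hx : HasPhase x α) (hy : HasPhase y β) : HasPhase (x * y) (α + β) := by
  unfold HasPhase at *
  rw [norm_mul, circleMap_zero_one_add, Complex.ofReal_mul, mul_mul_mul_comm, ← hx, ← hy]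

theorem one : HasPhase 1 0 := by
  rw [HasPhase, circleMap_zero_one_zero, norm_one, Complex.ofReal_one, one_mul]

theorem pow (hx : HasPhase x α) (n : ℕ) : HasPhase (x ^ n) (n * α) := by
  induction n with
  | zero => simpa only [pow_zero, Nat.cast_zero, zero_mul] using one
  | succ n ih => simpa only [pow_succ, Nat.cast_succ, add_one_mul] using ih.mul hx

theorem prod {ι : Type*} (s : Finset ι) {x : ι → ℂ} {α : ι → ℝ}
    (h : ∀ i ∈ s, HasPhase (x i) (α i)) : HasPhase (∏ i ∈ s, x i) (∑ i ∈ s, α i) := by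
  classical
  induction s using Finset.induction_on with
  | empty => exact one
  | insert a s ha ih =>
    rw [Finset.prod_insert ha, Finset.sum_insert ha]
    exact (h a (Finset.mem_insert_self a s)).mul
      (ih fun i hi => h i (Finset.mem_insert_of_mem hi))

theorem im_eq (hx : HasPhase x α) : x.im = ‖x‖ * Real.sin α := by
  have h := congrArg Complex.im hx
  rwa [Complex.im_ofReal_mul, circleMap_zero, Complex.ofReal_one, one_mul,
    Complex.exp_ofReal_mul_I_im] at h

theorem re_eq_norm (hx : HasPhase x 0) : x.re = ‖x‖ := by
  have h := congrArg Complex.re hx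
  rwa [circleMap_zero_one_zero, mul_one, Complex.ofReal_re] at h

theorem cpow (x : ℂ) (q : ℝ) : HasPhase (x ^ (q : ℂ)) (q * x.arg) := by
  rw [HasPhase, Complex.norm_cpow_real, Complex.cpow_ofReal, circleMap_zero, Complex.ofReal_one,
    one_mul, Complex.exp_mul_I, mul_comm q, Complex.ofReal_cos, Complex.ofReal_sin]

end HasPhase

theorem hasPhase_circleMap (θ : ℝ) : HasPhase (circleMap 0 1 θ) θ := by simp [HasPhase]

theorem arg_one_sub_circleMap {u : ℝ} (h0 : 0 < u) (h1 : u < 2 * π) :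
    (1 - circleMap 0 1 u).arg = (u - π) / 2 := by
  have hsin : 0 < 2 * Real.sin (u / 2) :=
    mul_pos two_pos (Real.sin_pos_of_pos_of_lt_pi (by linarith) (by linarith))
  have hI : circleMap 0 1 (-π / 2) = -Complex.I := by
    rw [circleMap_zero, Complex.ofReal_one, one_mul, ← Complex.exp_neg_pi_div_two_mul_I]
    push_cast
    rfl
  have hpolar : 1 - circleMap 0 1 u = (2 * Real.sin (u / 2) : ℝ) *
      (Complex.cos ((u - π) / 2 : ℝ) + Complex.sin ((u - π) / 2 : ℝ) * Complex.I) := by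
    rw [← Complex.exp_mul_I, ← one_mul (Complex.exp _), ← Complex.ofReal_one, ← circleMap_zero,
      show (u - π) / 2 = -π / 2 + u / 2 by ring, circleMap_zero_one_add, hI, Complex.ofReal_one,
      ← neg_sub, circleMap_zero_one_sub_one]
    push_cast
    ring
  rw [hpolar, Complex.arg_mul_cos_add_sin_mul_I hsin
    ⟨by linarith [Real.pi_pos], by linarith⟩]

theorem arg_one_sub_circleMap_of_neg {u : ℝ} (h0 : u < 0) (h1 : -(2 * π) < u) :
    (1 - circleMap 0 1 u).arg = (u + π) / 2 := by
  rw [← periodic_circleMap 0 1 u, arg_one_sub_circleMap (by linarith) (by linarith)]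
  ring

/-- The principal branch of `(1 - z * w) ^ q`; for `‖z * w‖ ≤ 1` the base stays in the closed right
half plane. -/
noncomputable def linearPow (q : ℝ) (w z : ℂ) : ℂ := (1 - z * w) ^ (q : ℂ)

section LinearPow

variable {q : ℝ} {w z : ℂ}

theorem re_one_sub_nonneg (hz : ‖z‖ ≤ 1) : 0 ≤ (1 - z).re := by
  rw [Complex.sub_re, Complex.one_re, sub_nonneg]
  exact (Complex.re_le_norm z).trans hz

theorem re_one_sub_pos (hz : ‖z‖ ≤ 1) (hne : z ≠ 1) : 0 < (1 - z).re := by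
  refine (re_one_sub_nonneg hz).lt_of_ne fun h => hne ?_
  rw [Complex.sub_re, Complex.one_re, eq_comm, sub_eq_zero] at h
  have him : z.im = 0 := by
    have hsq := Complex.sq_norm_sub_sq_re z
    rw [← h] at hsq
    nlinarith [norm_nonneg z, sq_nonneg z.im]
  exact Complex.ext h.symm him

theorem norm_linearPow_conj (hw : ‖w‖ = 1) : ‖linearPow q (conj w) z‖ = ‖z - w‖ ^ q := by
  have hfac : 1 - z * conj w = (w - z) * conj w := by
    rw [sub_mul, Complex.mul_conj', hw, Complex.ofReal_one, one_pow]
  rw [linearPow, Complex.norm_cpow_real, hfac, norm_mul, Complex.norm_conj, hw, mul_one,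
    norm_sub_rev]

theorem continuousOn_linearPow (hq : 0 < q) (hw : ‖w‖ ≤ 1) :
    ContinuousOn (linearPow q w) (closedBall 0 1) := by
  intro z hz
  have hzw : ‖z * w‖ ≤ 1 := by
    rw [norm_mul]
    exact mul_le_one₀ (mem_closedBall_zero_iff.1 hz) (norm_nonneg w) hw
  have hpow := Complex.continuousAt_cpow_const_of_re_pos (w := (q : ℂ))
    (Or.inl (re_one_sub_nonneg hzw)) (by rwa [Complex.ofReal_re])
  exact (ContinuousAt.comp (f := fun z => 1 - z * w) hpow (by fun_prop)).continuousWithinAt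

theorem differentiableAt_linearPow (hz : ‖z‖ ≤ 1) (hw : ‖w‖ ≤ 1) (hne : z * w ≠ 1) :
    DifferentiableAt ℂ (linearPow q w) z := by
  have hzw : ‖z * w‖ ≤ 1 := by
    rw [norm_mul]
    exact mul_le_one₀ hz (norm_nonneg w) hw
  exact DifferentiableAt.cpow_const (by fun_prop) (Or.inl (re_one_sub_pos hzw hne))

theorem linearPow_conj (hz : ‖z‖ ≤ 1) (hw : ‖w‖ ≤ 1) :
    linearPow q (conj w) (conj z) = conj (linearPow q w z) := by
  have hzw : ‖z * w‖ ≤ 1 := by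
    rw [norm_mul]
    exact mul_le_one₀ hz (norm_nonneg w) hw
  have harg : (1 - z * w).arg ≠ π := fun h =>
    (re_one_sub_nonneg hzw).not_gt (Complex.arg_eq_pi_iff.1 h).1
  have h := Complex.conj_cpow _ (q : ℂ) harg
  rw [Complex.conj_ofReal, map_sub, map_one, map_mul] at h
  exact h

theorem hasPhase_linearPow {θ u : ℝ} (h0 : 0 < θ + u) (h1 : θ + u < 2 * π) :
    HasPhase (linearPow q (circleMap 0 1 u) (circleMap 0 1 θ)) (q * ((θ + u - π) / 2)) := by
  rw [linearPow, ← circleMap_zero_one_add, ← arg_one_sub_circleMap h0 h1]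
  exact HasPhase.cpow _ q

theorem hasPhase_linearPow_of_neg {θ u : ℝ} (h0 : θ + u < 0) (h1 : -(2 * π) < θ + u) :
    HasPhase (linearPow q (circleMap 0 1 u) (circleMap 0 1 θ)) (q * ((θ + u + π) / 2)) := by
  rw [linearPow, ← circleMap_zero_one_add, ← arg_one_sub_circleMap_of_neg h0 h1]
  exact HasPhase.cpow _ q

-- The phase of the factors belonging to the zeros `e ^ (± i s)` drops by `q π` at `θ = s`.
theorem hasPhase_linearPow_conj_mul_linearPow {θ s : ℝ} (hθ : 0 ≤ θ) (hθ' : θ < π) (hs : 0 < s)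
    (hs' : s ≤ π) (hne : θ ≠ s) :
    HasPhase (linearPow q (conj (circleMap 0 1 s)) (circleMap 0 1 θ) *
      linearPow q (circleMap 0 1 s) (circleMap 0 1 θ)) (q * (θ - if s < θ then π else 0)) := by
  rw [← circleMap_zero_one_neg]
  have hadd : HasPhase (linearPow q (circleMap 0 1 s) (circleMap 0 1 θ)) (q * ((θ + s - π) / 2)) :=
    hasPhase_linearPow (by linarith) (by linarith)
  rcases hne.lt_or_gt with hlt | hlt
  · rw [if_neg hlt.not_gt]
    convert (hasPhase_linearPow_of_neg (q := q) (θ := θ) (u := -s)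
      (by linarith) (by linarith)).mul hadd using 1
    ring
  · rw [if_pos hlt]
    convert (hasPhase_linearPow (q := q) (θ := θ) (u := -s)
      (by linarith) (by linarith)).mul hadd using 1
    ring

end LinearPow

/-- The branch, holomorphic in the unit disc, of the `q`-th power of
`(1 + z) ^ e * ∏ j, (1 - z * conj (w j)) * (1 - z * w j)`. -/
noncomputable def branchPow {ι : Type*} [Fintype ι] (q : ℝ) (e : ℕ) (w : ι → ℂ) (z : ℂ) : ℂ :=
  linearPow q (-1) z ^ e * ∏ j, (linearPow q (conj (w j)) z * linearPow q (w j) z)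

section BranchPow

variable {ι : Type*} [Fintype ι] {q : ℝ} {e : ℕ} {w : ι → ℂ}

theorem norm_branchPow (hw : ∀ j, ‖w j‖ = 1) (z : ℂ) :
    ‖branchPow q e w z‖ = ‖(z + 1) ^ e * ∏ j, ((z - w j) * (z - conj (w j)))‖ ^ q := by
  have hneg : ‖linearPow q (-1) z‖ = ‖z + 1‖ ^ q := by
    simpa using norm_linearPow_conj (q := q) (w := -1) (z := z) (by simp)
  have hconj (j : ι) : ‖linearPow q (w j) z‖ = ‖z - conj (w j)‖ ^ q := by
    simpa using norm_linearPow_conj (q := q) (w := conj (w j)) (z := z) (by simpa using hw j)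
  simp only [branchPow, norm_mul, norm_pow, norm_prod, hneg, hconj, norm_linearPow_conj (hw _)]
  rw [Real.mul_rpow (by positivity) (by positivity), Real.rpow_pow_comm (norm_nonneg _),
    ← Real.finsetProd_rpow _ _ fun j _ => by positivity]
  simp only [Real.mul_rpow (norm_nonneg _) (norm_nonneg _)]

theorem differentiableAt_branchPow {z : ℂ} (hz : ‖z‖ ≤ 1) (hw : ∀ j, ‖w j‖ ≤ 1)
    (hne : z * -1 ≠ 1) (hne_conj : ∀ j, z * conj (w j) ≠ 1) (hne' : ∀ j, z * w j ≠ 1) :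
    DifferentiableAt ℂ (branchPow q e w) z :=
  ((differentiableAt_linearPow hz (by simp) hne).pow e).mul
    (DifferentiableAt.fun_finsetProd fun j _ =>
      (differentiableAt_linearPow hz (by simpa using hw j) (hne_conj j)).mul
        (differentiableAt_linearPow hz (hw j) (hne' j)))

theorem differentiableAt_branchPow_one (hw : ∀ j, ‖w j‖ ≤ 1) (hne : ∀ j, w j ≠ 1) :
    DifferentiableAt ℂ (branchPow q e w) 1 := by
  refine differentiableAt_branchPow (by simp) hw (by norm_num) (fun j h => hne j ?_)
    fun j => by rw [one_mul]; exact hne j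
  simpa using congrArg conj h

theorem diffContOnCl_branchPow (hq : 0 < q) (hw : ∀ j, ‖w j‖ ≤ 1) :
    DiffContOnCl ℂ (branchPow q e w) (ball 0 1) := by
  have hw_conj (j : ι) : ‖conj (w j)‖ ≤ 1 := by simpa using hw j
  have hne {z v : ℂ} (hz : z ∈ ball (0 : ℂ) 1) (hv : ‖v‖ ≤ 1) : z * v ≠ 1 := fun h => by
    have hlt := mul_lt_one_of_nonneg_of_lt_one_left (norm_nonneg z) (mem_ball_zero_iff.1 hz) hv
    rw [← norm_mul, h, norm_one] at hlt
    exact hlt.false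
  refine ⟨fun z hz => (differentiableAt_branchPow (mem_ball_zero_iff.1 hz).le hw
    (hne hz (by simp)) (fun j => hne hz (hw_conj j))
    fun j => hne hz (hw j)).differentiableWithinAt, ?_⟩
  rw [closure_ball _ one_ne_zero]
  exact ((continuousOn_linearPow hq (by simp)).pow e).mul (continuousOn_finsetProd _ fun j _ =>
    (continuousOn_linearPow hq (hw_conj j)).mul (continuousOn_linearPow hq (hw j)))

theorem branchPow_conj {z : ℂ} (hz : ‖z‖ ≤ 1) (hw : ∀ j, ‖w j‖ ≤ 1) :
    branchPow q e w (conj z) = conj (branchPow q e w z) := by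
  have hneg := linearPow_conj (q := q) (w := -1) hz (by simp)
  rw [map_neg, map_one] at hneg
  rw [branchPow, branchPow, map_mul, map_pow, map_prod, hneg]
  congr 1
  refine Finset.prod_congr rfl fun j _ => ?_
  have hw_conj : ‖conj (w j)‖ ≤ 1 := by simpa using hw j
  have h := linearPow_conj (q := q) hz hw_conj
  rw [Complex.conj_conj] at h
  rw [linearPow_conj hz (hw j), h, map_mul, mul_comm]

theorem hasPhase_branchPow {θ : ℝ} (hθ : 0 ≤ θ) (hθ' : θ < π) {s : ι → ℝ}
    (hs : ∀ j, s j ∈ Ioc 0 π) (hne : ∀ j, θ ≠ s j) :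
    HasPhase (branchPow q e (fun j => circleMap 0 1 (s j)) (circleMap 0 1 θ))
      (q * (e * (θ / 2) + ∑ j, (θ - if s j < θ then π else 0))) := by
  have hneg : HasPhase (linearPow q (-1) (circleMap 0 1 θ)) (q * (θ / 2)) := by
    have h := hasPhase_linearPow (q := q) (θ := θ) (u := π) (by linarith) (by linarith)
    rwa [circleMap_zero, Complex.ofReal_one, one_mul, Complex.exp_pi_mul_I,
      add_sub_cancel_right] at h
  have h := (hneg.pow e).mul (HasPhase.prod Finset.univ fun j _ =>
    hasPhase_linearPow_conj_mul_linearPow (q := q) hθ hθ' (hs j).1 (hs j).2 (hne j))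
  rw [← Finset.mul_sum, mul_left_comm, ← mul_add] at h
  exact h

theorem re_branchPow_one {s : ι → ℝ} (hs : ∀ j, s j ∈ Ioc 0 π) :
    (branchPow q e (fun j => circleMap 0 1 (s j)) 1).re =
      ‖branchPow q e (fun j => circleMap 0 1 (s j)) 1‖ := by
  have h := hasPhase_branchPow (q := q) (e := e) le_rfl Real.pi_pos hs fun j => (hs j).1.ne
  simp only [fun j => (hs j).1.not_gt, if_false, sub_zero, zero_div, mul_zero, zero_add,
    Finset.sum_const_zero] at h
  rw [circleMap_zero_one_zero] at h
  exact h.re_eq_norm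

end BranchPow

theorem exists_mem_Ioo_castSucc_succ {α : Type*} [LinearOrder α] {m : ℕ} {τ : Fin (m + 1) → α}
    {x : α} (h0 : τ 0 < x) (h1 : x < τ (Fin.last m)) (hx : x ∉ range τ) :
    ∃ n : Fin m, x ∈ Ioo (τ n.castSucc) (τ n.succ) := by
  by_contra! h
  have hlt (i : Fin (m + 1)) : τ i < x := by
    induction i using Fin.induction with
    | zero => exact h0
    | succ i ih => exact (not_lt.1 fun hi => h i ⟨ih, hi⟩).lt_of_ne fun hi => hx ⟨_, hi⟩
  exact (hlt _).not_gt h1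

section Kernel

variable {d : ℕ} {p q : ℝ} {τ : Fin (d / 2 + 2) → ℝ} {θ : ℝ} {n : Fin (d / 2 + 1)}

theorem K_eq_of_mem_Ioo (hτ : Monotone τ) (hn : θ ∈ Ioo (τ n.castSucc) (τ n.succ)) :
    K d p τ θ = Real.sin ((d * p / 4 + 1 / 2) * θ - p / 2 * π * (n : ℕ)) / Real.sin (θ / 2) := by
  have hother (m : Fin (d / 2 + 1)) (hm : m ≠ n) : θ ∉ Ioo (τ m.castSucc) (τ m.succ) := by
    rintro ⟨h1, h2⟩
    rcases hm.lt_or_gt with hlt | hlt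
    · exact (h2.trans_le (hτ (Fin.succ_le_castSucc_iff.2 hlt))).not_gt hn.1
    · exact (hn.2.trans_le (hτ (Fin.succ_le_castSucc_iff.2 hlt))).not_gt h1
  rw [K, Finset.sum_eq_single n (fun m _ hm => indicator_of_notMem (hother m hm) _)
    fun h => absurd (Finset.mem_univ n) h, indicator_of_mem hn]

theorem lt_iff_of_mem_Ioo (hτ : Monotone τ) (hn : θ ∈ Ioo (τ n.castSucc) (τ n.succ))
    (j : Fin (d / 2)) : τ j.succ.castSucc < θ ↔ (j : ℕ) < n := by
  refine ⟨fun h => ?_, fun h => (hτ ?_).trans_lt hn.1⟩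
  · by_contra! hle
    exact (hn.2.trans_le (hτ (Fin.le_def.2 (by simpa using hle)))).not_gt h
  · exact Fin.le_def.2 (by simpa using h)

theorem sum_sub_ite_lt (hτ : Monotone τ) (hn : θ ∈ Ioo (τ n.castSucc) (τ n.succ)) :
    ∑ j : Fin (d / 2), (θ - if τ j.succ.castSucc < θ then π else 0) =
      (d / 2 : ℕ) * θ - n * π := by
  have hcard : (Finset.univ.filter fun j : Fin (d / 2) => (j : ℕ) < n).card = n := by
    rw [Fin.card_filter_val_lt, min_eq_right (Nat.lt_succ_iff.1 n.2)]
  simp only [lt_iff_of_mem_Ioo hτ hn]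
  rw [Finset.sum_sub_distrib, ← Finset.sum_filter, Finset.sum_const, Finset.sum_const, hcard,
    Finset.card_univ, Fintype.card_fin, nsmul_eq_mul, nsmul_eq_mul]

variable (d q τ) in
/-- The branch in the unit disc of the `q`-th power of a polynomial with zero arguments `τ`, in the
sense of `HasZeroArgs`, up to a constant factor. -/
noncomputable def zeroArgsPow : ℂ → ℂ :=
  branchPow q (d % 2) fun j : Fin (d / 2) => circleMap 0 1 (τ j.succ.castSucc)

theorem norm_zeroArgsPow_mul_K (hτ : τ ∈ T d) (hpos : ∀ j : Fin (d / 2), 0 < τ j.succ.castSucc)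
    (hθ : θ ∈ Ioo 0 π) (hne : θ ∉ range τ) :
    ‖zeroArgsPow d (p / 2) τ (circleMap 0 1 θ)‖ * K d p τ θ =
      (zeroArgsPow d (p / 2) τ (circleMap 0 1 θ) * circleMap 0 1 (θ / 2)).im /
        Real.sin (θ / 2) := by
  obtain ⟨hmono, hτ0, hτl⟩ := hτ
  obtain ⟨n, hn⟩ := exists_mem_Ioo_castSucc_succ (hτ0 ▸ hθ.1) (hτl ▸ hθ.2) hne
  have hphase : HasPhase (zeroArgsPow d (p / 2) τ (circleMap 0 1 θ)) _ :=
    hasPhase_branchPow hθ.1.le hθ.2 (fun j => ⟨hpos j, hτl ▸ hmono (Fin.le_last _)⟩)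
      fun j h => hne ⟨_, h.symm⟩
  have hangle : p / 2 * ((d % 2 : ℕ) * (θ / 2) + ((d / 2 : ℕ) * θ - n * π)) + θ / 2 =
      (d * p / 4 + 1 / 2) * θ - p / 2 * π * (n : ℕ) := by
    have hd : (d : ℝ) = (d % 2 : ℕ) + 2 * (d / 2 : ℕ) := by
      exact_mod_cast (Nat.mod_add_div d 2).symm
    rw [hd]
    ring
  rw [sum_sub_ite_lt hmono hn] at hphase
  rw [(hphase.mul (hasPhase_circleMap (θ / 2))).im_eq, hangle, norm_mul, norm_circleMap_zero,
    abs_one, mul_one, K_eq_of_mem_Ioo hmono hn, ← mul_div_assoc]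

theorem integral_norm_zeroArgsPow_mul_K (hp : 0 < p) (hτ : τ ∈ T d)
    (hpos : ∀ j : Fin (d / 2), 0 < τ j.succ.castSucc) :
    ∫ θ in 0..π, ‖zeroArgsPow d (p / 2) τ (circleMap 0 1 θ)‖ * K d p τ θ =
      π * ‖zeroArgsPow d (p / 2) τ 1‖ := by
  have hmem (j : Fin (d / 2)) : τ j.succ.castSucc ∈ Ioc 0 π :=
    ⟨hpos j, hτ.2.2 ▸ hτ.1 (Fin.le_last _)⟩
  have hnorm (j : Fin (d / 2)) : ‖circleMap 0 1 (τ j.succ.castSucc)‖ ≤ 1 := by simp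
  have hne (j : Fin (d / 2)) : circleMap 0 1 (τ j.succ.castSucc) ≠ 1 :=
    circleMap_zero_one_ne_one (sin_half_pos (hmem j)).ne'
  have hae : ∀ᵐ θ, θ ∈ uIoc 0 π → ‖zeroArgsPow d (p / 2) τ (circleMap 0 1 θ)‖ * K d p τ θ =
      (zeroArgsPow d (p / 2) τ (circleMap 0 1 θ) * circleMap 0 1 (θ / 2)).im /
        Real.sin (θ / 2) := by
    filter_upwards [(finite_range τ).countable.ae_notMem volume] with θ hθ hmem
    rw [uIoc_of_le Real.pi_pos.le] at hmem
    exact norm_zeroArgsPow_mul_K hτ hpos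
      ⟨hmem.1, hmem.2.lt_of_ne fun h => hθ ⟨_, hτ.2.2.trans h.symm⟩⟩ hθ
  rw [intervalIntegral.integral_congr_ae hae]
  unfold zeroArgsPow
  rw [integral_im_mul_circleMap_half_div_sin_half (diffContOnCl_branchPow (half_pos hp) hnorm)
    (differentiableAt_branchPow_one hnorm hne)
    fun z hz => branchPow_conj (mem_sphere_zero_iff_norm.1 hz).le hnorm, re_branchPow_one hmem]

namespace HasZeroArgs

variable {φ : ℂ[X]}

theorem norm_eval_rpow (h : HasZeroArgs d φ τ) (q : ℝ) :
    ∃ c : ℝ, ∀ z : ℂ, ‖φ.eval z‖ ^ q = c * ‖zeroArgsPow d q τ z‖ := by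
  obtain ⟨c, -, rfl⟩ := h
  refine ⟨‖c‖ ^ q, fun z => ?_⟩
  rw [zeroArgsPow, norm_branchPow (by simp), ← Real.mul_rpow (norm_nonneg _) (norm_nonneg _),
    ← norm_mul]
  simp [eval_prod, mul_assoc, circleMap_zero, ← Complex.exp_conj]

theorem pos_of_not_isRoot_one (h : HasZeroArgs d φ τ) (hτ : τ ∈ T d) (hone : ¬ φ.IsRoot 1)
    (j : Fin (d / 2)) : 0 < τ j.succ.castSucc := by
  obtain ⟨hmono, hτ0, -⟩ := hτ
  have hnonneg : 0 ≤ τ j.succ.castSucc := hτ0.symm.trans_le (hmono (Fin.zero_le _))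
  refine hnonneg.lt_of_ne fun hj => hone ?_
  obtain ⟨c, -, rfl⟩ := h
  rw [IsRoot, eval_mul, eval_prod, Finset.prod_eq_zero (Finset.mem_univ j), mul_zero]
  rw [← hj]
  simp

theorem norm_eval_conj_rpow (h : HasZeroArgs d φ τ) {z : ℂ} (hz : ‖z‖ ≤ 1) (q : ℝ) :
    ‖φ.eval (conj z)‖ ^ q = ‖φ.eval z‖ ^ q := by
  obtain ⟨c, hc⟩ := h.norm_eval_rpow q
  rw [hc, hc, zeroArgsPow, branchPow_conj hz (by simp), Complex.norm_conj]

theorem integral_norm_eval_rpow_mul_K (h : HasZeroArgs d φ τ) (hp : 0 < p) (hτ : τ ∈ T d)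
    (hone : ¬ φ.IsRoot 1) :
    ∫ θ in 0..π, ‖φ.eval (circleMap 0 1 θ)‖ ^ (p / 2) * K d p τ θ =
      π * ‖φ.eval 1‖ ^ (p / 2) := by
  obtain ⟨c, hc⟩ := h.norm_eval_rpow (p / 2)
  simp only [hc, mul_assoc]
  rw [intervalIntegral.integral_const_mul,
    integral_norm_zeroArgsPow_mul_K hp hτ (h.pos_of_not_isRoot_one hτ hone), mul_left_comm]

end HasZeroArgs

end Kernel

theorem ofReal_integral_le_lintegral_ofReal {α : Type*} [MeasurableSpace α] (μ : Measure α)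
    (f : α → ℝ) : ENNReal.ofReal (∫ x, f x ∂μ) ≤ ∫⁻ x, ENNReal.ofReal (f x) ∂μ := by
  by_cases hf : Integrable f μ
  · calc ENNReal.ofReal (∫ x, f x ∂μ) ≤ ENNReal.ofReal (∫ x, max (f x) 0 ∂μ) :=
          ENNReal.ofReal_le_ofReal (integral_mono hf hf.pos_part fun x => le_max_left _ _)
      _ = ∫⁻ x, ENNReal.ofReal (max (f x) 0) ∂μ :=
          ofReal_integral_eq_lintegral_ofReal hf.pos_part (ae_of_all _ fun x => le_max_right _ _)
      _ = ∫⁻ x, ENNReal.ofReal (f x) ∂μ := by simp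
  · rw [integral_undef hf, ENNReal.ofReal_zero]
    exact zero_le

theorem sq_ofReal_integral_mul_le {α : Type*} [MeasurableSpace α] {μ : Measure α} {f g : α → ℝ}
    (hf0 : 0 ≤ f) (hf : AEMeasurable f μ) (hg : AEMeasurable g μ) :
    ENNReal.ofReal (∫ x, f x * g x ∂μ) ^ 2 ≤
      (∫⁻ x, ENNReal.ofReal (f x) ^ 2 ∂μ) * ∫⁻ x, ENNReal.ofReal (g x) ^ 2 ∂μ := by
  have h := (ofReal_integral_le_lintegral_ofReal μ fun x => f x * g x).trans
    ((lintegral_congr fun x => ENNReal.ofReal_mul (hf0 x)).trans_le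
      (ENNReal.lintegral_mul_le_Lp_mul_Lq μ Real.HolderConjugate.two_two
        hf.ennreal_ofReal hg.ennreal_ofReal))
  have hsqrt (x : ENNReal) : (x ^ (1 / 2 : ℝ)) ^ 2 = x := by
    rw [← ENNReal.rpow_mul_natCast, Nat.cast_ofNat, one_div_mul_cancel two_ne_zero,
      ENNReal.rpow_one]
  simpa only [mul_pow, hsqrt, ENNReal.rpow_two] using pow_le_pow_left' h 2

theorem measurable_K (d : ℕ) (p : ℝ) (τ : Fin (d / 2 + 2) → ℝ) : Measurable (K d p τ) := by
  unfold K
  refine Finset.measurable_fun_sum _ fun n _ => Measurable.indicator ?_ measurableSet_Ioo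
  fun_prop

theorem K_le (d : ℕ) (p : ℝ) (τ : Fin (d / 2 + 2) → ℝ) (θ : ℝ) :
    K d p τ θ ≤ ∑ _n : Fin (d / 2 + 1), |Real.sin (θ / 2)|⁻¹ := by
  refine Finset.sum_le_sum fun n _ => indicator_apply_le' (fun _ => ?_) fun _ => by positivity
  rw [← one_div]
  refine (le_abs_self _).trans ?_
  rw [abs_div]
  exact div_le_div_of_nonneg_right (Real.abs_sin_le_one _) (abs_nonneg _)

theorem max_K_zero_le_M {d : ℕ} {p : ℝ} {Λ : Set (Fin (d / 2 + 2) → ℝ)}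
    {τ : Fin (d / 2 + 2) → ℝ} (hτ : τ ∈ Λ) (θ : ℝ) : max (K d p τ θ) 0 ≤ M d p Λ θ := by
  refine le_csSup ⟨∑ _n : Fin (d / 2 + 1), |Real.sin (θ / 2)|⁻¹, ?_⟩ (mem_image_of_mem _ hτ)
  rintro _ ⟨σ, -, rfl⟩
  exact max_le (K_le d p σ θ) (Finset.sum_nonneg fun _ _ => by positivity)

theorem sq_ofReal_K_le {d : ℕ} {p : ℝ} {Λ : Set (Fin (d / 2 + 2) → ℝ)}
    {τ : Fin (d / 2 + 2) → ℝ} (hτ : τ ∈ Λ) (θ : ℝ) :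
    ENNReal.ofReal (K d p τ θ) ^ 2 ≤ ENNReal.ofReal (M d p Λ θ ^ 2) := by
  obtain ⟨hK, h0⟩ := max_le_iff.1 (max_K_zero_le_M (p := p) hτ θ)
  rw [ENNReal.ofReal_pow h0]
  exact pow_le_pow_left' (ENNReal.ofReal_le_ofReal hK) 2

theorem HasZeroArgs.lintegral_norm_eval_rpow {d : ℕ} {p : ℝ} {φ : ℂ[X]}
    {τ : Fin (d / 2 + 2) → ℝ} (h : HasZeroArgs d φ τ) (hp : 0 ≤ p) :
    ∫⁻ θ in Ioc 0 π, ENNReal.ofReal (‖φ.eval (circleMap 0 1 θ)‖ ^ p) =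
      ENNReal.ofReal (π * lpNormPow p φ) := by
  have hint := circleIntegrable_norm_eval_rpow hp φ
  rw [lpNormPow, ← smul_eq_mul, ← integral_zero_pi_circleMap hint fun z hz =>
    h.norm_eval_conj_rpow (mem_sphere_zero_iff_norm.1 hz).le p,
    intervalIntegral.integral_of_le Real.pi_pos.le, ofReal_integral_eq_lintegral_ofReal]
  · exact ((continuous_norm_eval_rpow hp φ).comp
      (continuous_circleMap 0 1)).integrableOn_Ioc
  · exact ae_of_all _ fun θ => by positivity

-- Cauchy–Schwarz in the reproducing formula, after the negative part of the kernel is dropped.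
theorem HasZeroArgs.sq_ofReal_pi_le {d : ℕ} {p : ℝ} {φ : ℂ[X]} {τ : Fin (d / 2 + 2) → ℝ}
    (h : HasZeroArgs d φ τ) (hp : 0 < p) (hτ : τ ∈ T d) (hone : φ.eval 1 = 1)
    {Λ : Set (Fin (d / 2 + 2) → ℝ)} (hΛ : τ ∈ Λ) :
    ENNReal.ofReal π ^ 2 ≤ ENNReal.ofReal (π * lpNormPow p φ) *
      ∫⁻ θ in Icc 0 π, ENNReal.ofReal (M d p Λ θ ^ 2) := by
  have hrepr := h.integral_norm_eval_rpow_mul_K hp hτ (by rw [IsRoot, hone]; exact one_ne_zero)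
  rw [hone, norm_one, Real.one_rpow, mul_one, intervalIntegral.integral_of_le Real.pi_pos.le]
    at hrepr
  have hmeas : Measurable fun θ => ‖φ.eval (circleMap 0 1 θ)‖ ^ (p / 2) :=
    ((continuous_norm_eval_rpow (half_pos hp).le φ).comp (continuous_circleMap 0 1)).measurable
  have hsq (θ : ℝ) : ENNReal.ofReal (‖φ.eval (circleMap 0 1 θ)‖ ^ (p / 2)) ^ 2 =
      ENNReal.ofReal (‖φ.eval (circleMap 0 1 θ)‖ ^ p) := by
    rw [← ENNReal.ofReal_pow (by positivity), ← Real.rpow_mul_natCast (norm_nonneg _),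
      Nat.cast_ofNat, div_mul_cancel₀ p two_ne_zero]
  calc ENNReal.ofReal π ^ 2
      = ENNReal.ofReal
          (∫ θ in Ioc 0 π, ‖φ.eval (circleMap 0 1 θ)‖ ^ (p / 2) * K d p τ θ) ^ 2 := by rw [hrepr]
    _ ≤ (∫⁻ θ in Ioc 0 π, ENNReal.ofReal (‖φ.eval (circleMap 0 1 θ)‖ ^ (p / 2)) ^ 2) *
          ∫⁻ θ in Ioc 0 π, ENNReal.ofReal (K d p τ θ) ^ 2 :=
        sq_ofReal_integral_mul_le (fun θ => by positivity) hmeas.aemeasurable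
          (measurable_K d p τ).aemeasurable
    _ = ENNReal.ofReal (π * lpNormPow p φ) * ∫⁻ θ in Icc 0 π, ENNReal.ofReal (K d p τ θ) ^ 2 := by
        simp only [hsq]
        rw [h.lintegral_norm_eval_rpow hp.le, restrict_Ioc_eq_restrict_Icc]
    _ ≤ ENNReal.ofReal (π * lpNormPow p φ) *
          ∫⁻ θ in Icc 0 π, ENNReal.ofReal (M d p Λ θ ^ 2) := by
        gcongr with θ
        exact sq_ofReal_K_le hΛ θ

theorem IsExtremal.ofReal_nikolskiiConst_le_energy {d : ℕ} {p : ℝ} {φ : ℂ[X]}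
    (hφ : IsExtremal d p φ) (hp : 0 < p) {τ : Fin (d / 2 + 2) → ℝ} (hτ : τ ∈ T d)
    (hz : HasZeroArgs d φ τ) {Λ : Set (Fin (d / 2 + 2) → ℝ)} (hΛ : τ ∈ Λ) :
    ENNReal.ofReal (nikolskiiConst d p) ≤ energy d p Λ := by
  set m := lpNormPow p φ
  have hm0 : 0 < m := lpNormPow_pos hp hφ.ne_zero
  set I := ∫⁻ θ in Icc 0 π, ENNReal.ofReal (M d p Λ θ ^ 2) with hI
  have hπ := Real.pi_pos
  calc ENNReal.ofReal (nikolskiiConst d p)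
      ≤ ENNReal.ofReal m⁻¹ := ENNReal.ofReal_le_ofReal (hφ.nikolskiiConst_le hp)
    _ = ENNReal.ofReal (π * (π * m))⁻¹ * ENNReal.ofReal π ^ 2 := by
        rw [← ENNReal.ofReal_pow hπ.le, ← ENNReal.ofReal_mul (by positivity)]
        congr 1
        field_simp
    _ ≤ ENNReal.ofReal (π * (π * m))⁻¹ * (ENNReal.ofReal (π * m) * I) := by
        gcongr
        exact hz.sq_ofReal_pi_le hp hτ hφ.eval_one hΛ
    _ = energy d p Λ := by
        rw [energy, ← hI, ← mul_assoc, ← ENNReal.ofReal_mul (by positivity)]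
        congr 2
        field_simp

end PointEval

theorem theorem3p1_general (d : ℕ) {p : ℝ} (hp : 1 ≤ p) :
    ∃ (φ : Polynomial ℂ) (t : Fin (d / 2 + 2) → ℝ),
      PointEval.IsExtremal d p φ ∧ t ∈ PointEval.T d ∧ PointEval.HasZeroArgs d φ t ∧
      ∀ Λ : Set (Fin (d / 2 + 2) → ℝ), t ∈ Λ →
        ENNReal.ofReal (PointEval.nikolskiiConst d p) ≤ PointEval.energy d p Λ := by
  have hp0 : 0 < p := one_pos.trans_le hp
  obtain ⟨φ, hφ, hconj⟩ := PointEval.exists_isExtremal_map_conj_eq hp d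
  obtain ⟨t, ht, hz⟩ := PointEval.exists_mem_T_hasZeroArgs (hφ.natDegree_eq hp0) hφ.ne_zero hconj
    fun w hw => ⟨hφ.norm_eq_one_of_isRoot hp0 hw, fun h => hφ.not_isRoot_one (h ▸ hw)⟩
  exact ⟨φ, t, hφ, ht, hz, fun Λ hΛ => hφ.ofReal_nikolskiiConst_le_energy hp0 ht hz hΛ⟩

theorem theorem3p1 (d : ℕ) (hd : 2 ≤ d) (p : ℝ) (hp : 2 ≤ p) :
    ENNReal.ofReal (PointEval.nikolskiiConst d p) ≤ PointEval.energy d p (PointEval.T d) ∧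
    ∃ (φ : Polynomial ℂ) (t : Fin (d / 2 + 2) → ℝ),
      PointEval.IsExtremal d p φ ∧ t ∈ PointEval.T d ∧ PointEval.HasZeroArgs d φ t ∧
      ∀ Λ : Set (Fin (d / 2 + 2) → ℝ), Λ ⊆ PointEval.T d → t ∈ Λ →
        ENNReal.ofReal (PointEval.nikolskiiConst d p) ≤ PointEval.energy d p Λ := by
  obtain ⟨φ, t, hφ, ht, hz, h⟩ := theorem3p1_general d (by linarith : 1 ≤ p)
  exact ⟨h _ ht, φ, t, hφ, ht, hz, fun Λ _ => h Λ⟩
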